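/- **Setting.** A finite-horizon MDP has decision epochs $h\in\{0,\dots,H-1\}$ ($H\ge 1$), a finite state space $\mathcal S=\mathcal S_0\cup\dots\cup\mathcal S_{H-1}$, a finite action space $\mathcal A=\bigcup_{s\in\mathcal S}\mathcal A_s$ with every $\mathcal A_s\neq\emptyset$, rewards $r(s,a)\in[0,R^*]$ for $a\in\mathcal A_s$, where $R^*>0$, and transition probabilities $p(\cdot\mid s,a)$ on $\mathcal S$ with $p(\mathcal S_{h+1}\mid s,a)=1$ for $h<H-1$, $s\in\mathcal S_h$, $a\in\mathcal A_s$. A policy $\pi=(\pi_h)_{h=0}^{H-1}$ assigns to each $h$ and $s\in\mathcal S_h$ a probability measure $\pi_h(\cdot\mid s)$ on $\mathcal A_s$. Let $$V_h^{\pi}(\mu)=\mathbb E\Big[\sum_{k=h}^{H-1} r(S_k,A_k)\Big],\qquad S_h\sim\mu,\; A_k\sim\pi_k(\cdot\mid S_k),\; S_{k+1}\sim p(\cdot\mid S_k,A_k),$$ $V_h^\pi(s)=V_h^\pi(\delta_s)$, $V_0^*(s)=\sup_\pi V_0^\pi(s)$, and $Q_h^\pi(s,a)=r(s,a)+\sum_{s'\in\mathcal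 S_{h+1}}p(s'\mid s,a)V_{h+1}^\pi(s')$ for $h\le H-2$, $Q_{H-1}^\pi=r$. For $\theta=(\theta(s,a))_{s\in\mathcal S_h,a\in\mathcal A_s}$ let $\pi^{\theta}(a\mid s)=e^{\theta(s,a)}/\sum_{a'\in\mathcal A_s}e^{\theta(s,a')}$. **Dynamic policy gradient.** Given start distributions $\mu_h$ on $\mathcal S_h$ with $\mu_h(s)>0$ for all $s\in\mathcal S_h$, step sizes $\eta_h=\frac{1}{2(H-h)R^*}$, arbitrary initial parameters $\theta_h^{(0)}$ and numbers of steps $N_h\in\mathbb N$, define backwards for $h=H-1,\dots,0$ $$\theta_h^{(n+1)}=\theta_h^{(n)}+\eta_h\nabla_{\theta}V_h^{(\pi^{\theta},\hat\pi^*_{h+1},\dots,\hat\pi^*_{H-1})}(\mu_h)\Big|_{\theta=\theta_h^{(n)}}\quad(n\ge0),\qquad \hat\pi_h^*=\pi^{\theta_h^{(N_h)}}.$$ A choice of best actions is a family $a_h^*(s)\in\arg\max_{a\in\mathcal A_s}Q_h^{\hat\pi^*}(s,a)$, $h<H$, $s\in\mathcal S_h$. For such a choice put $c_h=\inf_{n\ge0}\min_{s\in\mathcal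 S_h}\pi^{\theta_h^{(n)}}(a_h^*(s)\mid s)$; it depends on the $N_k$ only for $k>h$. Let $\|1/\mu_h\|_\infty=\max_{s\in\mathcal S_h}1/\mu_h(s)$ and let $\epsilon>0$. **Theorem.** 1. There is a choice of best actions with $c_h>0$ for every $h$. (In particular $c_h>0$ for every $h$ whenever the best actions are unique.) 2. For every choice of best actions such that, for all $h$, $c_h>0$ and $$N_h\ \ge\ \frac{4(H-h)HR^*}{c_h^2\,\epsilon}\Big\|\frac1{\mu_h}\Big\|_\infty ,$$ one has $V_0^*(s)-V_0^{\hat\pi^*}(s)\le\epsilon$ for all $s\in\mathcal S_0$. 3. At every epoch $h$ at which $\pi^{\theta_h^{(0)}}(\cdot\mid s)$ is the uniform distribution on $\mathcal A_s$ for all $s\in\mathcal S_h$, the condition in 2 may be replaced by the same lower bound on $N_h$ with $1/|\mathcal A|$ in place of $c_h$, and the conclusion still holds. -/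

import Mathlib

/-- A finite-horizon Markov decision process with decision epochs `0, …, horizon - 1`, finite state
space `S = ⋃ h < horizon, states h` (the sets `states h` may overlap), finite action space
`A = ⋃ s, actions s`, reward function `r` and transition function `p`; `p s a s'` is the
probability of moving from `s` to `s'` under action `a`. The values `states h` for
`h ≥ horizon` play no role. -/
structure FiniteMDP (S A : Type*) [Fintype S] [Fintype A] where
  horizon : ℕ
  horizon_pos : 0 < horizon
  states : ℕ → Finset S
  states_cover : ∀ s, ∃ h < horizon, s ∈ states h
  actions : S → Finset A
  actions_nonempty : ∀ s, (actions s).Nonempty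
  actions_cover : ∀ a, ∃ s, a ∈ actions s
  r : S → A → ℝ
  p : S → A → S → ℝ
  p_mem : ∀ s a, p s a ∈ stdSimplex ℝ S
  p_states : ∀ h, h + 1 < horizon → ∀ s ∈ states h, ∀ a ∈ actions s,
    ∑ s' ∈ states (h + 1), p s a s' = 1

namespace FiniteMDP

noncomputable section

variable {S A : Type*} [Fintype S] [Fintype A] [DecidableEq S] [DecidableEq A]
  (M : FiniteMDP S A)

/-- `π h s a` is the probability of choosing `a` in state `s` at epoch `h`. Only epochs
`h < horizon` and states `s ∈ states h` matter. -/
def IsPolicy (π : ℕ → S → A → ℝ) : Prop :=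
  ∀ h < M.horizon, ∀ s ∈ M.states h,
    π h s ∈ stdSimplex ℝ A ∧ ∑ a ∈ M.actions s, π h s a = 1

/-- Probability of the trajectory `τ = (s_h, a_h, …, s_{h+n}, a_{h+n})` when `S_h ∼ μ`,
`A_k ∼ π_k(·|S_k)` and `S_{k+1} ∼ p(·|S_k, A_k)`. -/
def trajProb (π : ℕ → S → A → ℝ) (h : ℕ) (μ : S → ℝ) {n : ℕ} (τ : Fin (n + 1) → S × A) : ℝ :=
  μ (τ 0).1 *
    (∏ i : Fin n, M.p (τ i.castSucc).1 (τ i.castSucc).2 (τ i.succ).1) *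
    ∏ i : Fin (n + 1), π (h + i) (τ i).1 (τ i).2

/-- The value `V_h^π(μ) = E_μ^π [∑_{k=h}^{H-1} r(S_k, A_k)]` for `h < horizon`, as the sum over all
trajectories from epoch `h` to the last epoch. It depends on `π` only through the epochs
`h, …, horizon - 1`. -/
def value (π : ℕ → S → A → ℝ) (h : ℕ) (μ : S → ℝ) : ℝ :=
  ∑ τ : Fin (M.horizon - 1 - h + 1) → S × A,
    M.trajProb π h μ τ * ∑ i, M.r (τ i).1 (τ i).2

/-- The state value `V_h^π(s) = V_h^π(δ_s)`. -/
def stateValue (π : ℕ → S → A → ℝ) (h : ℕ) (s : S) : ℝ :=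
  M.value π h (Pi.single s 1)

/-- The optimal value `V_0^*(s)`, the supremum of `V_0^π(s)` over all policies. -/
def optValue (s : S) : ℝ :=
  ⨆ π : {π : ℕ → S → A → ℝ // M.IsPolicy π}, M.stateValue π.1 0 s

/-- The state-action value `Q_h^π(s, a)`; it depends on `π` only through the epochs after `h`. -/
def qValue (π : ℕ → S → A → ℝ) (h : ℕ) (s : S) (a : A) : ℝ :=
  M.r s a +
    if h + 1 < M.horizon then
      ∑ s' ∈ M.states (h + 1), M.p s a s' * M.stateValue π (h + 1) s'
    else 0

/-- The admissible state-action pairs of epoch `h`; there are `d_h` of them. -/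
abbrev Pair (h : ℕ) : Type _ := {x : S × A // x.1 ∈ M.states h ∧ x.2 ∈ M.actions x.1}

/-- The parameter space `ℝ^{d_h}` of epoch `h`, with the Euclidean inner product. -/
abbrev Param (h : ℕ) : Type _ := EuclideanSpace ℝ (M.Pair h)

/-- `exp (θ(s, a))` for an admissible pair, and `0` otherwise. -/
def expParam {h : ℕ} (θ : M.Param h) (s : S) (a : A) : ℝ :=
  if hx : s ∈ M.states h ∧ a ∈ M.actions s then Real.exp (θ ⟨(s, a), hx⟩) else 0

/-- Tabular softmax parametrisation: for `s ∈ states h` and `a ∈ actions s` this is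
`exp (θ(s, a)) / ∑_{a' ∈ actions s} exp (θ(s, a'))`. -/
def softmax {h : ℕ} (θ : M.Param h) (s : S) (a : A) : ℝ :=
  M.expParam θ s a / ∑ a', M.expParam θ s a'

/-- The objective `J_h(θ, π_{(h+1)}, μ)`: the value of following the softmax policy of `θ` at
epoch `h` and `π` afterwards. -/
def objective (π : ℕ → S → A → ℝ) (h : ℕ) (μ : S → ℝ) (θ : M.Param h) : ℝ :=
  M.value (Function.update π h (M.softmax θ)) h μ

/-- Exact gradient ascent on `J_h(·, π_{(h+1)}, μ)` with constant step size `η`. -/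
def gradAscent (π : ℕ → S → A → ℝ) (h : ℕ) (μ : S → ℝ) (η : ℝ) (θ₀ : M.Param h) :
    ℕ → M.Param h
  | 0 => θ₀
  | n + 1 =>
    gradAscent π h μ η θ₀ n + η • gradient (M.objective π h μ) (gradAscent π h μ η θ₀ n)

/-- The policy after the last `k` epochs `horizon - k, …, horizon - 1` have been trained, backwards
in time. The entries of earlier epochs are placeholders. -/
def trained (η : ℕ → ℝ) (μ : ℕ → S → ℝ) (θ₀ : (h : ℕ) → M.Param h) (N : ℕ → ℕ) :
    ℕ → ℕ → S → A → ℝ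
  | 0 => fun _ _ _ => 0
  | k + 1 =>
    let π := trained η μ θ₀ N k
    let h := M.horizon - 1 - k
    Function.update π h (M.softmax (M.gradAscent π h (μ h) (η h) (θ₀ h) (N h)))

/-- The iterates `θ_h^{(n)}`, `n ≥ 0`, of dynamic policy gradient at epoch `h`, started when all
epochs after `h` have been trained. -/
def iterate (η : ℕ → ℝ) (μ : ℕ → S → ℝ) (θ₀ : (h : ℕ) → M.Param h) (N : ℕ → ℕ)
    (h n : ℕ) : M.Param h :=
  M.gradAscent (M.trained η μ θ₀ N (M.horizon - 1 - h)) h (μ h) (η h) (θ₀ h) n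

/-- The final policy of dynamic policy gradient: at epoch `h`, the softmax policy of
`θ_h^{(N_h)}`. -/
def finalPolicy (η : ℕ → ℝ) (μ : ℕ → S → ℝ) (θ₀ : (h : ℕ) → M.Param h) (N : ℕ → ℕ) :
    ℕ → S → A → ℝ :=
  fun h => M.softmax (M.iterate η μ θ₀ N h (N h))

/-- `aStar h s` is a best action at epoch `h` in state `s` if `π` is followed afterwards. -/
def IsBestAction (π : ℕ → S → A → ℝ) (aStar : ℕ → S → A) : Prop :=
  ∀ h < M.horizon, ∀ s ∈ M.states h, aStar h s ∈ M.actions s ∧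
    ∀ a ∈ M.actions s, M.qValue π h s a ≤ M.qValue π h s (aStar h s)

/-- `c_h = inf_{n ≥ 0} min_{s ∈ states h} π^{θ_h^{(n)}}(aStar h s | s)`. -/
def cConst (η : ℕ → ℝ) (μ : ℕ → S → ℝ) (θ₀ : (h : ℕ) → M.Param h) (N : ℕ → ℕ)
    (aStar : ℕ → S → A) (h : ℕ) : ℝ :=
  ⨅ n : ℕ, ⨅ s : M.states h, M.softmax (M.iterate η μ θ₀ N h n) s (aStar h s)

/-- The softmax policy of `θ` is uniform on `actions s` for every `s ∈ states h`. -/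
def IsUniform {h : ℕ} (θ : M.Param h) : Prop :=
  ∀ s ∈ M.states h, ∀ a ∈ M.actions s, M.softmax θ s a = 1 / ((M.actions s).card : ℝ)

/-- `‖1 / ν‖_∞ = max_{s ∈ states h} 1 / ν(s)`. -/
def invNorm (h : ℕ) (ν : S → ℝ) : ℝ :=
  ⨆ s : M.states h, 1 / ν s

/-- The number of training steps `4 (H - h) H R ‖1/ν‖_∞ / (c² ε)`. -/
def steps (R ε : ℝ) (h : ℕ) (ν : S → ℝ) (c : ℝ) : ℝ :=
  4 * ((M.horizon : ℝ) - h) * M.horizon * R / (c ^ 2 * ε) * M.invNorm h ν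

end

end FiniteMDP

/-!
Fix an epoch `h` and the policies `π̂` already trained for the later epochs. By the Bellman equation
(`FiniteMDP.value_eq`) the objective of the epoch is `∑ s, μ_h(s) ∑ a, π^θ(a|s) Q(s, a)` with
`Q = Q_h^π̂` independent of `θ`, so that different states involve disjoint sets of parameters. Every
state is a softmax bandit with known rewards `Q(s, ·)` in `[0, (H - h) R]`, and the algorithm runs
exact gradient ascent on it with step size `t = η_h μ_h(s) ≤ 1 / (2 (H - h) R)`
(`FiniteMDP.gradAscent_isAscent`). The rest of the argument concerns one such bandit, with weights
`w_a`, mean `v = ∑ w_a Q_a` and logit increments `t w_a (Q_a - v)`.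

* One step multiplies the unnormalised weight of `a` by `exp (t w_a (Q_a - v)) ≤ 2`, and
  `x (exp (t x) - 1) ≥ 0` for every real `x`. Hence a step raises `v` by at least
  `t / 2 * (w_a (Q_a - v)) ^ 2` for the best arm `a` (`SoftmaxBandit.mean_add_le_mean_step`). If
  `w_a ≥ c` throughout, then `δ = Q_a - v` satisfies `δ' ≤ δ - t c² / 2 * δ²`, whence the rate
  `δ_n ≤ 2 / (t c² n)` (`SoftmaxBandit.IsAscent.rate`), which at `n = N_h` is at most `ε / H`.
* The mean converges to the best reward (`SoftmaxBandit.IsAscent.tendsto_mean`), and the order of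
  the logits of two arms is preserved if the better arm is ahead and its reward is above all means
  (`SoftmaxBandit.IsAscent.le_of_le`). Therefore the best arm with the largest initial logit stays
  the most likely best arm, and its weight is bounded away from zero
  (`SoftmaxBandit.IsAscent.exists_weight_ge`). When all logits start equal, every best arm stays
  the most likely arm, and its weight is at least `1 / |A|`.

Finally, if `π̂` is within `ε / H` of greedy for its own `Q`-function at all epochs, then
backward induction over the epochs shows that no policy exceeds its value by more than `ε`
(`FiniteMDP.stateValue_le_add`).
-/

namespace SoftmaxBandit

noncomputable section

open Filter Topology

variable {ι : Type*} {K : Finset ι} {Q : ι → ℝ} {t L : ℝ}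

/-! ### Softmax bandits -/

/-- The softmax probability of the arm `a` among the arms in `K`, for the logits `θ`. -/
def weight (K : Finset ι) (θ : ι → ℝ) (a : ι) : ℝ :=
  Real.exp (θ a) / ∑ b ∈ K, Real.exp (θ b)

/-- The expected reward of the softmax policy with logits `θ` on the arms in `K`. -/
def mean (K : Finset ι) (Q θ : ι → ℝ) : ℝ :=
  ∑ a ∈ K, weight K θ a * Q a

/-- `θ` is a run of gradient ascent with step size `t` on the expected reward: the partial
derivative of `mean K Q` in the direction of `a` is `weight a * (Q a - mean)`. Logits of arms
outside `K` are unconstrained. -/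
def IsAscent (K : Finset ι) (Q : ι → ℝ) (t : ℝ) (θ : ℕ → ι → ℝ) : Prop :=
  ∀ n, ∀ a ∈ K, θ (n + 1) a = θ n a + t * (weight K (θ n) a * (Q a - mean K Q (θ n)))

lemma sum_exp_pos (hK : K.Nonempty) (θ : ι → ℝ) : 0 < ∑ b ∈ K, Real.exp (θ b) :=
  Finset.sum_pos (fun _ _ => Real.exp_pos _) hK

lemma weight_pos (hK : K.Nonempty) (θ : ι → ℝ) (a : ι) : 0 < weight K θ a :=
  div_pos (Real.exp_pos _) (sum_exp_pos hK θ)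

lemma sum_weight (hK : K.Nonempty) (θ : ι → ℝ) : ∑ a ∈ K, weight K θ a = 1 := by
  unfold weight
  rw [← Finset.sum_div, div_self (sum_exp_pos hK θ).ne']

lemma weight_le_one (hK : K.Nonempty) (θ : ι → ℝ) {a : ι} (ha : a ∈ K) : weight K θ a ≤ 1 := by
  rw [← sum_weight hK θ]
  exact Finset.single_le_sum (f := weight K θ) (fun b _ => (weight_pos hK θ b).le) ha

lemma weight_le_weight (hK : K.Nonempty) {θ : ι → ℝ} {a b : ι} (h : θ a ≤ θ b) :
    weight K θ a ≤ weight K θ b :=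
  div_le_div_of_nonneg_right (Real.exp_le_exp.2 h) (sum_exp_pos hK θ).le

lemma weight_eq_mul_exp (θ : ι → ℝ) (a b : ι) :
    weight K θ a = weight K θ b * Real.exp (θ a - θ b) := by
  unfold weight
  rw [Real.exp_sub]
  field_simp

lemma sum_weight_mul_sub (hK : K.Nonempty) (θ : ι → ℝ) (x : ℝ) :
    ∑ a ∈ K, weight K θ a * (Q a - x) = mean K Q θ - x := by
  simp only [mul_sub, Finset.sum_sub_distrib, ← Finset.sum_mul, sum_weight hK θ, one_mul, mean]

lemma sum_weight_mul_sub_mean (hK : K.Nonempty) (θ : ι → ℝ) :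
    ∑ a ∈ K, weight K θ a * (Q a - mean K Q θ) = 0 := by
  rw [sum_weight_mul_sub hK, sub_self]

lemma mean_le (hK : K.Nonempty) (θ : ι → ℝ) {x : ℝ} (h : ∀ a ∈ K, Q a ≤ x) :
    mean K Q θ ≤ x := by
  have := sum_weight_mul_sub (Q := Q) hK θ x
  have h2 : ∑ a ∈ K, weight K θ a * (Q a - x) ≤ 0 := Finset.sum_nonpos fun a ha =>
    mul_nonpos_of_nonneg_of_nonpos (weight_pos hK θ a).le (by linarith [h a ha])
  linarith

lemma le_mean (hK : K.Nonempty) (θ : ι → ℝ) {x : ℝ} (h : ∀ a ∈ K, x ≤ Q a) :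
    x ≤ mean K Q θ := by
  have := sum_weight_mul_sub (Q := Q) hK θ x
  have h2 : 0 ≤ ∑ a ∈ K, weight K θ a * (Q a - x) := Finset.sum_nonneg fun a ha =>
    mul_nonneg (weight_pos hK θ a).le (by linarith [h a ha])
  linarith

/-! ### One step of gradient ascent -/

/-- Quantitative ascent without a smoothness argument. With `q a = Q a - mean θ` the new mean
exceeds the old one by `∑ exp (θ a) * q a * (exp (t * weight a * q a) - 1)` divided by the new
normalising sum. Every summand is nonnegative, so that it suffices to keep a single arm. -/
lemma mean_add_le_mean_step (hK : K.Nonempty) (ht : 0 ≤ t) (hL : ∀ a ∈ K, 0 ≤ Q a ∧ Q a ≤ L)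
    (htL : t * L ≤ 1 / 2) {θ θ' : ι → ℝ}
    (hθ : ∀ a ∈ K, θ' a = θ a + t * (weight K θ a * (Q a - mean K Q θ)))
    {a : ι} (ha : a ∈ K) (hQ : mean K Q θ ≤ Q a) :
    mean K Q θ + t / 2 * (weight K θ a * (Q a - mean K Q θ)) ^ 2 ≤ mean K Q θ' := by
  set v := mean K Q θ with hv
  set w := weight K θ with hw
  have hv0 : 0 ≤ v := le_mean hK θ fun a ha => (hL a ha).1
  have hvL : v ≤ L := mean_le hK θ fun a ha => (hL a ha).2
  set Z := ∑ b ∈ K, Real.exp (θ b) with hZ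
  set Z' := ∑ b ∈ K, Real.exp (θ' b) with hZ'
  have hZpos : 0 < Z := sum_exp_pos hK θ
  have hZ'pos : 0 < Z' := sum_exp_pos hK θ'
  have hE : ∀ b, Real.exp (θ b) = Z * w b := fun b => by
    rw [hw]; unfold weight; rw [← hZ]; field_simp
  have hE' : ∀ b ∈ K, Real.exp (θ' b) = Z * w b * Real.exp (t * (w b * (Q b - v))) :=
    fun b hb => by rw [hθ b hb, Real.exp_add, hE]
  have hZ2 : Z' ≤ 2 * Z := by
    have : ∀ b ∈ K, Real.exp (θ' b) ≤ 2 * Real.exp (θ b) := by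
      intro b hb
      rw [hE' b hb, hE b, mul_comm 2]
      refine mul_le_mul_of_nonneg_left ?_ (mul_pos hZpos (weight_pos hK θ b)).le
      have h1 : t * (w b * (Q b - v)) ≤ 1 / 2 := by
        have h2 : w b * (Q b - v) ≤ L := by
          have h3 := weight_le_one hK θ hb
          have h4 := weight_pos hK θ b
          have h5 := (hL b hb).2
          rcases le_total 0 (Q b - v) with h | h
          · exact (mul_le_of_le_one_left h h3).trans (by linarith)
          · exact (mul_nonpos_of_nonneg_of_nonpos h4.le h).trans (hv0.trans hvL)
        exact (mul_le_mul_of_nonneg_left h2 ht).trans htL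
      calc Real.exp (t * (w b * (Q b - v))) ≤ Real.exp (1 / 2) := Real.exp_le_exp.2 h1
        _ ≤ Real.exp (Real.log 2) := Real.exp_le_exp.2 (by linarith [Real.log_two_gt_d9])
        _ = 2 := Real.exp_log (by norm_num)
    calc Z' ≤ ∑ b ∈ K, 2 * Real.exp (θ b) := Finset.sum_le_sum this
      _ = 2 * Z := by rw [← Finset.mul_sum]
  have hkey : Z' * (mean K Q θ' - v) =
      ∑ b ∈ K, Z * (w b * (Q b - v)) * (Real.exp (t * (w b * (Q b - v))) - 1) := by
    have h0 : ∑ b ∈ K, Z * (w b * (Q b - v)) = 0 := by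
      rw [← Finset.mul_sum, hw, hv, sum_weight_mul_sub_mean hK θ, mul_zero]
    rw [← sum_weight_mul_sub hK θ' v, Finset.mul_sum]
    simp only [mul_sub _ _ (1 : ℝ), mul_one, Finset.sum_sub_distrib, h0, sub_zero]
    refine Finset.sum_congr rfl fun b hb => ?_
    unfold weight
    rw [← hZ', hE' b hb]
    field_simp
  have hterm : ∀ x : ℝ, 0 ≤ x * (Real.exp (t * x) - 1) := by
    intro x
    rcases le_total 0 x with h | h
    · exact mul_nonneg h (by linarith [Real.one_le_exp (mul_nonneg ht h)])
    · exact mul_nonneg_of_nonpos_of_nonpos h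
        (by linarith [Real.exp_le_one_iff.2 (mul_nonpos_of_nonneg_of_nonpos ht h)])
  have hnn : ∀ b ∈ K,
      0 ≤ Z * (w b * (Q b - v)) * (Real.exp (t * (w b * (Q b - v))) - 1) := fun b _ => by
    rw [mul_assoc]; exact mul_nonneg hZpos.le (hterm _)
  have hge : Z * (t * (w a * (Q a - v)) ^ 2) ≤ Z' * (mean K Q θ' - v) := by
    rw [hkey]
    refine le_trans ?_ (Finset.single_le_sum hnn ha)
    have hg : 0 ≤ w a * (Q a - v) := mul_nonneg (weight_pos hK θ a).le (by linarith)
    have := Real.add_one_le_exp (t * (w a * (Q a - v)))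
    rw [mul_assoc]
    refine mul_le_mul_of_nonneg_left ?_ hZpos.le
    nlinarith
  have hpos : 0 ≤ mean K Q θ' - v := by
    have : 0 ≤ Z' * (mean K Q θ' - v) := hkey ▸ Finset.sum_nonneg hnn
    exact nonneg_of_mul_nonneg_right this hZ'pos
  have h2 : Z * (t * (w a * (Q a - v)) ^ 2) ≤ Z * (2 * (mean K Q θ' - v)) := by
    nlinarith
  have := le_of_mul_le_mul_left h2 hZpos
  linarith

variable {θ : ℕ → ι → ℝ}

lemma IsAscent.mean_monotone (h : IsAscent K Q t θ) (hK : K.Nonempty) (ht : 0 ≤ t)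
    (hL : ∀ a ∈ K, 0 ≤ Q a ∧ Q a ≤ L) (htL : t * L ≤ 1 / 2) :
    Monotone fun n => mean K Q (θ n) := by
  refine monotone_nat_of_le_succ fun n => ?_
  obtain ⟨a, ha, hmax⟩ := K.exists_max_image Q hK
  have := mean_add_le_mean_step hK ht hL htL (h n) ha (mean_le hK (θ n) hmax)
  have h2 : 0 ≤ t / 2 * (weight K (θ n) a * (Q a - mean K Q (θ n))) ^ 2 := by positivity
  linarith

/-! ### The `1 / n` rate -/

/-- A recursive inequality `δ (n + 1) ≤ δ n - κ * δ n ^ 2` forces `δ n ≤ 1 / (κ * n)`. -/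
lemma mul_mul_le_one_of_le_sub_sq {δ : ℕ → ℝ} {κ : ℝ} (hκ : 0 ≤ κ) (h0 : ∀ n, 0 ≤ δ n)
    (h : ∀ n, δ (n + 1) ≤ δ n - κ * δ n ^ 2) (n : ℕ) : n * (κ * δ n) ≤ 1 := by
  induction n with
  | zero => simp
  | succ n ih =>
    push_cast
    have hx : 0 ≤ κ * δ n := mul_nonneg hκ (h0 n)
    have hy : κ * δ (n + 1) ≤ κ * δ n * (1 - κ * δ n) := by
      nlinarith [mul_le_mul_of_nonneg_left (h n) hκ]
    have hn : (0 : ℝ) ≤ n := n.cast_nonneg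
    generalize κ * δ n = x at *
    have h1 : ((n : ℝ) + 1) * (κ * δ (n + 1)) ≤ (n + 1) * (x * (1 - x)) :=
      mul_le_mul_of_nonneg_left hy (by linarith)
    refine h1.trans ?_
    rcases le_total x 1 with hx1 | hx1
    · nlinarith [mul_le_mul_of_nonneg_right ih (sub_nonneg.2 hx1)]
    · nlinarith [mul_nonneg (mul_nonneg (by linarith : (0 : ℝ) ≤ n + 1) hx) (sub_nonneg.2 hx1)]

lemma IsAscent.rate (h : IsAscent K Q t θ) (hK : K.Nonempty) (ht : 0 ≤ t)
    (hL : ∀ a ∈ K, 0 ≤ Q a ∧ Q a ≤ L) (htL : t * L ≤ 1 / 2) {a : ι} (ha : a ∈ K)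
    (hmax : ∀ b ∈ K, Q b ≤ Q a) {c : ℝ} (hc : 0 ≤ c) (hw : ∀ n, c ≤ weight K (θ n) a) (n : ℕ) :
    n * (t * c ^ 2 / 2 * (Q a - mean K Q (θ n))) ≤ 1 := by
  refine mul_mul_le_one_of_le_sub_sq (δ := fun n => Q a - mean K Q (θ n)) (by positivity)
    (fun n => sub_nonneg.2 (mean_le hK _ hmax)) (fun n => ?_) n
  have h1 := mean_add_le_mean_step hK ht hL htL (h n) ha (mean_le hK (θ n) hmax)
  have h2 : c ^ 2 ≤ weight K (θ n) a ^ 2 := pow_le_pow_left₀ hc (hw n) 2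
  have h3 := mul_le_mul_of_nonneg_right h2
    (mul_nonneg (div_nonneg ht zero_le_two) (sq_nonneg (Q a - mean K Q (θ n))))
  nlinarith

/-! ### Convergence of gradient ascent -/

/-- An arm `a` whose reward stays above the means is never overtaken by an arm that is no
better: if `a` is ahead, its weight and its advantage `Q a - mean` are both the larger ones, so
its logit grows faster. -/
lemma IsAscent.le_of_le (h : IsAscent K Q t θ) (hK : K.Nonempty) (ht : 0 ≤ t) {a b : ι}
    (ha : a ∈ K) (hb : b ∈ K) (hQ : Q b ≤ Q a) (hm : ∀ n, mean K Q (θ n) ≤ Q a)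
    (h0 : θ 0 b ≤ θ 0 a) (n : ℕ) : θ n b ≤ θ n a := by
  induction n with
  | zero => exact h0
  | succ n ih =>
    rw [h n a ha, h n b hb]
    have h1 := weight_le_weight hK ih
    have h2 := weight_pos hK (θ n) b
    have h3 : weight K (θ n) b * (Q b - mean K Q (θ n)) ≤
        weight K (θ n) a * (Q a - mean K Q (θ n)) :=
      (mul_le_mul_of_nonneg_left (by linarith) h2.le).trans
        (mul_le_mul_of_nonneg_right h1 (by linarith [hm n]))
    linarith [mul_le_mul_of_nonneg_left h3 ht]

lemma IsAscent.inv_card_le_weight (h : IsAscent K Q t θ) (hK : K.Nonempty) (ht : 0 ≤ t) {a : ι}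
    (ha : a ∈ K) (hmax : ∀ b ∈ K, Q b ≤ Q a) (h0 : ∀ b ∈ K, θ 0 b ≤ θ 0 a) (n : ℕ) :
    1 / (K.card : ℝ) ≤ weight K (θ n) a := by
  have hcard : (0 : ℝ) < K.card := by exact_mod_cast hK.card_pos
  rw [div_le_iff₀ hcard, ← sum_weight hK (θ n), mul_comm, ← nsmul_eq_mul]
  exact Finset.sum_le_card_nsmul _ _ _ fun b hb => weight_le_weight hK <|
    h.le_of_le hK ht ha hb (hmax b hb) (fun n => mean_le hK _ hmax) (h0 b hb) n

lemma IsAscent.sum_eq (h : IsAscent K Q t θ) (hK : K.Nonempty) (n : ℕ) :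
    ∑ a ∈ K, θ n a = ∑ a ∈ K, θ 0 a := by
  induction n with
  | zero => rfl
  | succ n ih =>
    rw [Finset.sum_congr rfl (h n), Finset.sum_add_distrib, ← Finset.mul_sum,
      sum_weight_mul_sub_mean hK, mul_zero, add_zero, ih]

/-- Suppose that the means stay below some `V < Q a`, that every arm worse than `V` eventually has
a reward below the mean, and that the logit of `a` stays bounded. The total probability given to
`a` is then finite, hence so is that given to the arms worse than `V`; all other logits increase.
As the sum of the logits is preserved, all logits stay bounded, and the probability of `a` cannot
be summable. -/
lemma IsAscent.not_bddAbove (h : IsAscent K Q t θ) (hK : K.Nonempty) (ht : 0 < t)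
    (hL : ∀ a ∈ K, 0 ≤ Q a ∧ Q a ≤ L) {V : ℝ} (hV : ∀ n, mean K Q (θ n) ≤ V)
    (hlow : ∀ b ∈ K, Q b < V → ∀ᶠ n in atTop, Q b ≤ mean K Q (θ n))
    {a : ι} (ha : a ∈ K) (hVa : V < Q a) : ¬ BddAbove (Set.range fun n => θ n a) := by
  rintro ⟨B, hB⟩
  have hB : ∀ n, θ n a ≤ B := fun n => hB ⟨n, rfl⟩
  have hmono : ∀ b ∈ K, V ≤ Q b → Monotone fun n => θ n b := fun b hb hVb =>
    monotone_nat_of_le_succ fun n => by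
      rw [h n b hb]
      have := mul_nonneg ht.le (mul_nonneg (weight_pos hK (θ n) b).le
        (by linarith [hV n] : 0 ≤ Q b - mean K Q (θ n)))
      linarith
  have hL0 : 0 ≤ L := (hL a ha).1.trans (hL a ha).2
  have hmL : ∀ n, mean K Q (θ n) ≤ L := fun n => mean_le hK _ fun b hb => (hL b hb).2
  -- the probabilities of `a` are summable
  obtain ⟨C, hC⟩ : ∃ C, ∀ n, ∑ i ∈ Finset.range n, weight K (θ i) a ≤ C := by
    have hΔ : 0 < t * (Q a - V) := mul_pos ht (by linarith)
    refine ⟨(B - θ 0 a) / (t * (Q a - V)), fun n => ?_⟩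
    rw [le_div_iff₀ hΔ]
    have : ∀ n, (∑ i ∈ Finset.range n, weight K (θ i) a) * (t * (Q a - V)) ≤
        θ n a - θ 0 a := by
      intro n
      induction n with
      | zero => simp
      | succ n ih =>
        rw [Finset.sum_range_succ, add_mul, h n a ha]
        have := mul_le_mul_of_nonneg_left (hV n) (mul_pos ht (weight_pos hK (θ n) a)).le
        nlinarith
    linarith [this n, hB n]
  -- all logits are bounded from below
  have hbelow : ∀ b : ι, ∃ D, b ∈ K → ∀ n, D ≤ θ n b := by
    intro b
    rcases le_or_gt V (Q b) with hVb | hVb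
    · exact ⟨θ 0 b, fun hb n => hmono b hb hVb (Nat.zero_le n)⟩
    by_cases hb : b ∈ K
    swap
    · exact ⟨0, fun h => absurd h hb⟩
    obtain ⟨U, hU⟩ : BddAbove (Set.range fun n => θ n b) := by
      obtain ⟨n₀, hn₀⟩ := eventually_atTop.1 (hlow b hb hVb)
      refine Filter.IsBoundedUnder.bddAbove_range ⟨θ n₀ b, ?_⟩
      rw [eventually_map, eventually_atTop]
      refine ⟨n₀, fun n hn => ?_⟩
      induction n, hn using Nat.le_induction with
      | base => exact le_rfl
      | succ n hn ih =>
        rw [h n b hb]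
        have := mul_nonneg ht.le (mul_nonneg (weight_pos hK (θ n) b).le
          (sub_nonneg.2 (hn₀ n hn)))
        linarith
    have hU : ∀ n, θ n b ≤ U := fun n => hU ⟨n, rfl⟩
    set M := Real.exp (U - θ 0 a) with hM
    have hw : ∀ n, weight K (θ n) b ≤ weight K (θ n) a * M := fun n => by
      rw [weight_eq_mul_exp _ b a]
      refine mul_le_mul_of_nonneg_left (Real.exp_le_exp.2 ?_) (weight_pos hK _ _).le
      have : θ 0 a ≤ θ n a := hmono a ha hVa.le (Nat.zero_le n)
      linarith [hU n]
    have hlb : ∀ n, θ 0 b - t * L * M * ∑ i ∈ Finset.range n, weight K (θ i) a ≤ θ n b := by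
      intro n
      induction n with
      | zero => simp
      | succ n ih =>
        rw [Finset.sum_range_succ, h n b hb]
        have h1 : weight K (θ n) b * (mean K Q (θ n) - Q b) ≤ weight K (θ n) a * M * L :=
          (mul_le_mul_of_nonneg_left (by linarith [hmL n, (hL b hb).1] :
            mean K Q (θ n) - Q b ≤ L) (weight_pos hK _ _).le).trans
            (mul_le_mul_of_nonneg_right (hw n) hL0)
        nlinarith [mul_le_mul_of_nonneg_left h1 ht.le]
    refine ⟨θ 0 b - t * L * M * C, fun _ n => le_trans ?_ (hlb n)⟩
    have : 0 ≤ t * L * M := by positivity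
    linarith [mul_le_mul_of_nonneg_left (hC n) this]
  choose D hD using hbelow
  -- hence also from above
  have habove : ∀ n, ∀ b ∈ K, θ n b ≤ ∑ i ∈ K, θ 0 i - ∑ i ∈ K, D i + D b := by
    intro n b hb
    have := Finset.single_le_sum (f := fun i => θ n i - D i)
      (fun i hi => sub_nonneg.2 (hD i hi n)) hb
    rw [Finset.sum_sub_distrib, h.sum_eq hK] at this
    linarith
  set m := Real.exp (θ 0 a) / ∑ b ∈ K, Real.exp (∑ i ∈ K, θ 0 i - ∑ i ∈ K, D i + D b) with hm
  have hm0 : 0 < m := div_pos (Real.exp_pos _) (Finset.sum_pos (fun _ _ => Real.exp_pos _) hK)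
  have hmw : ∀ n, m ≤ weight K (θ n) a := fun n =>
    div_le_div₀ (Real.exp_pos _).le (Real.exp_le_exp.2 (hmono a ha hVa.le (Nat.zero_le n)))
      (sum_exp_pos hK _) (Finset.sum_le_sum fun b hb => Real.exp_le_exp.2 (habove n b hb))
  obtain ⟨n, hn⟩ := exists_nat_gt (C / m)
  rw [div_lt_iff₀ hm0] at hn
  have : (n : ℝ) * m ≤ ∑ i ∈ Finset.range n, weight K (θ i) a := by
    have := Finset.card_nsmul_le_sum (Finset.range n) (fun i => weight K (θ i) a) m
      fun i _ => hmw i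
    simpa using this
  linarith [hC n]

/-- Softmax gradient ascent converges to the best reward. Let `V` be the limit of the means and
suppose `V < Q a`. The logit of `a` tends to infinity, so that the arms worse than `V`, whose
logits are bounded above, lose all weight relative to `a`. But in the balance
`∑ weight b * (Q b - mean) = 0` only these arms can compensate for the arm `a`. -/
lemma IsAscent.tendsto_mean (h : IsAscent K Q t θ) (hK : K.Nonempty) (ht : 0 < t)
    (hL : ∀ a ∈ K, 0 ≤ Q a ∧ Q a ≤ L) (htL : t * L ≤ 1 / 2) {a : ι} (ha : a ∈ K)
    (hmax : ∀ b ∈ K, Q b ≤ Q a) : Tendsto (fun n => mean K Q (θ n)) atTop (𝓝 (Q a)) := by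
  have hmono := h.mean_monotone hK ht.le hL htL
  have hbdd : BddAbove (Set.range fun n => mean K Q (θ n)) :=
    ⟨Q a, by rintro _ ⟨n, rfl⟩; exact mean_le hK _ hmax⟩
  have hlim := tendsto_atTop_ciSup hmono hbdd
  set V := ⨆ n, mean K Q (θ n) with hVdef
  have hV : ∀ n, mean K Q (θ n) ≤ V := fun n => le_ciSup hbdd n
  have hVle : V ≤ Q a := ciSup_le fun n => mean_le hK _ hmax
  rcases hVle.eq_or_lt with hEq | hlt
  · rwa [hEq] at hlim
  exfalso
  have hlow : ∀ b ∈ K, Q b < V → ∀ᶠ n in atTop, Q b ≤ mean K Q (θ n) := fun b _ hb =>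
    (hlim.eventually_const_lt hb).mono fun n hn => hn.le
  have hL0 : 0 ≤ L := (hL a ha).1.trans (hL a ha).2
  have hmL : ∀ n, mean K Q (θ n) ≤ L := fun n => mean_le hK _ fun b hb => (hL b hb).2
  have hainf : Tendsto (fun n => θ n a) atTop atTop := by
    refine tendsto_atTop_atTop_of_monotone' (monotone_nat_of_le_succ fun n => ?_)
      (h.not_bddAbove hK ht hL hV hlow ha hlt)
    rw [h n a ha]
    have := mul_nonneg ht.le (mul_nonneg (weight_pos hK (θ n) a).le
      (by linarith [hV n] : 0 ≤ Q a - mean K Q (θ n)))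
    linarith
  have hzero : Tendsto (fun n => ∑ b ∈ K with Q b < V, L * Real.exp (θ n b - θ n a))
      atTop (𝓝 0) := by
    rw [← Finset.sum_const_zero (s := K.filter fun b => Q b < V)]
    refine tendsto_finsetSum _ fun b hb => ?_
    rw [Finset.mem_filter] at hb
    obtain ⟨n₀, hn₀⟩ := eventually_atTop.1 (hlow b hb.1 hb.2)
    have hb' : ∀ n ≥ n₀, θ n b ≤ θ n₀ b := fun n hn => by
      induction n, hn using Nat.le_induction with
      | base => exact le_rfl
      | succ n hn ih =>
        rw [h n b hb.1]
        have := mul_nonneg ht.le (mul_nonneg (weight_pos hK (θ n) b).le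
          (sub_nonneg.2 (hn₀ n hn)))
        linarith
    have : Tendsto (fun n => θ n b - θ n a) atTop atBot :=
      tendsto_atBot_mono' _ (eventually_atTop.2 ⟨n₀, fun n hn => sub_le_sub_right (hb' n hn) _⟩)
        (tendsto_const_nhds.add_atBot (tendsto_neg_atTop_atBot.comp hainf))
    simpa using (Real.tendsto_exp_atBot.comp this).const_mul L
  have hbal : ∀ n, Q a - V ≤ ∑ b ∈ K with Q b < V, L * Real.exp (θ n b - θ n a) := by
    intro n
    have hwa := weight_pos hK (θ n) a
    refine le_of_mul_le_mul_left ?_ hwa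
    have h0 := sum_weight_mul_sub_mean (Q := Q) hK (θ n)
    rw [← Finset.sum_filter_add_sum_filter_not K fun b => Q b < V] at h0
    have h1 : weight K (θ n) a * (Q a - mean K Q (θ n)) ≤
        ∑ b ∈ K with ¬ Q b < V, weight K (θ n) b * (Q b - mean K Q (θ n)) :=
      Finset.single_le_sum (f := fun b => weight K (θ n) b * (Q b - mean K Q (θ n)))
        (fun b hb => mul_nonneg (weight_pos hK _ _).le
          (by linarith [hV n, not_lt.1 (Finset.mem_filter.1 hb).2]))
        (Finset.mem_filter.2 ⟨ha, not_lt.2 hVle⟩)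
    have h2 : -(weight K (θ n) a * ∑ b ∈ K with Q b < V, L * Real.exp (θ n b - θ n a)) ≤
        ∑ b ∈ K with Q b < V, weight K (θ n) b * (Q b - mean K Q (θ n)) := by
      rw [Finset.mul_sum, ← Finset.sum_neg_distrib]
      refine Finset.sum_le_sum fun b hb => ?_
      rw [weight_eq_mul_exp (θ n) b a]
      have := mul_le_mul_of_nonneg_left
        (by linarith [hmL n, (hL b (Finset.mem_filter.1 hb).1).1] : mean K Q (θ n) - Q b ≤ L)
        (mul_pos hwa (Real.exp_pos (θ n b - θ n a))).le
      linarith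
    have h3 := mul_le_mul_of_nonneg_left (by linarith [hV n] : Q a - V ≤ Q a - mean K Q (θ n))
      hwa.le
    linarith
  linarith [ge_of_tendsto' hzero hbal]

/-- The best arm with the largest initial logit keeps a probability bounded away from zero: the
probability of all best arms together tends to `1`, and this arm stays the most likely of them. -/
lemma IsAscent.exists_weight_ge (h : IsAscent K Q t θ) (hK : K.Nonempty) (ht : 0 < t)
    (hL : ∀ a ∈ K, 0 ≤ Q a ∧ Q a ≤ L) (htL : t * L ≤ 1 / 2) :
    ∃ a ∈ K, (∀ b ∈ K, Q b ≤ Q a) ∧ ∃ c > 0, ∀ n, c ≤ weight K (θ n) a := by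
  obtain ⟨a₀, ha₀, hmax₀⟩ := K.exists_max_image Q hK
  obtain ⟨a, haB, hmaxθ⟩ := (K.filter fun b => Q a₀ ≤ Q b).exists_max_image (θ 0)
    ⟨a₀, Finset.mem_filter.2 ⟨ha₀, le_rfl⟩⟩
  obtain ⟨ha, haQ⟩ := Finset.mem_filter.1 haB
  have hmax : ∀ b ∈ K, Q b ≤ Q a := fun b hb => (hmax₀ b hb).trans haQ
  refine ⟨a, ha, hmax, ?_⟩
  have hbad : Tendsto (fun n => ∑ b ∈ K with ¬ Q a₀ ≤ Q b, weight K (θ n) b) atTop (𝓝 0) := by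
    rw [← Finset.sum_const_zero (s := K.filter fun b => ¬ Q a₀ ≤ Q b)]
    refine tendsto_finsetSum _ fun b hb => ?_
    obtain ⟨hbK, hbQ⟩ := Finset.mem_filter.1 hb
    have hgap : 0 < Q a - Q b := by linarith [not_le.1 hbQ]
    have hlim : Tendsto (fun n => (Q a - mean K Q (θ n)) / (Q a - Q b)) atTop (𝓝 0) := by
      simpa using ((h.tendsto_mean hK ht hL htL ha hmax).const_sub (Q a)).div_const (Q a - Q b)
    refine squeeze_zero (fun n => (weight_pos hK _ _).le) (fun n => ?_) hlim
    rw [le_div_iff₀ hgap]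
    have h1 := sum_weight_mul_sub (Q := Q) hK (θ n) (Q a)
    have h2 := Finset.single_le_sum (f := fun i => weight K (θ n) i * (Q a - Q i))
      (fun i hi => mul_nonneg (weight_pos hK _ _).le (sub_nonneg.2 (hmax i hi))) hbK
    have h3 : ∑ i ∈ K, weight K (θ n) i * (Q a - Q i) =
        -∑ i ∈ K, weight K (θ n) i * (Q i - Q a) := by
      rw [← Finset.sum_neg_distrib]
      exact Finset.sum_congr rfl fun i _ => by ring
    linarith
  have hcard : (0 : ℝ) < K.card := by exact_mod_cast hK.card_pos
  obtain ⟨U, hU⟩ : BddAbove (Set.range fun n => (weight K (θ n) a)⁻¹) := by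
    refine Filter.IsBoundedUnder.bddAbove_range ⟨2 * K.card, ?_⟩
    rw [eventually_map]
    filter_upwards [hbad.eventually_lt_const (by norm_num : (0 : ℝ) < 1 / 2)] with n hn
    have h1 := sum_weight hK (θ n)
    rw [← Finset.sum_filter_add_sum_filter_not K fun b => Q a₀ ≤ Q b] at h1
    have h2 : ∑ b ∈ K with Q a₀ ≤ Q b, weight K (θ n) b ≤ K.card * weight K (θ n) a := by
      rw [← nsmul_eq_mul]
      refine (Finset.sum_le_card_nsmul _ _ (weight K (θ n) a) fun b hb =>
        weight_le_weight hK ?_).trans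
        (nsmul_le_nsmul_left (weight_pos hK _ _).le (Finset.card_filter_le _ _))
      obtain ⟨hbK, hbQ⟩ := Finset.mem_filter.1 hb
      exact h.le_of_le hK ht.le ha hbK (hmax b hbK) (fun n => mean_le hK _ hmax)
        (hmaxθ b hb) n
    rw [inv_le_iff_one_le_mul₀ (weight_pos hK _ _)]
    linarith
  have hU : ∀ n, (weight K (θ n) a)⁻¹ ≤ U := fun n => hU ⟨n, rfl⟩
  have hU0 : 0 < U := (inv_pos.2 (weight_pos hK (θ 0) a)).trans_le (hU 0)
  exact ⟨U⁻¹, inv_pos.2 hU0, fun n => inv_le_of_inv_le₀ (weight_pos hK _ _) (hU n)⟩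

end

end SoftmaxBandit

namespace FiniteMDP

noncomputable section

set_option linter.unusedSectionVars false

variable {S A : Type*} [Fintype S] [Fintype A] [DecidableEq S] [DecidableEq A]
  (M : FiniteMDP S A)

/-! ### Bellman equations -/

/-- `π` is a policy at the epochs `k, …, horizon - 1`. -/
def IsPolicyFrom (k : ℕ) (π : ℕ → S → A → ℝ) : Prop :=
  ∀ h, k ≤ h → h < M.horizon → ∀ s ∈ M.states h,
    π h s ∈ stdSimplex ℝ A ∧ ∑ a ∈ M.actions s, π h s a = 1

variable {M} {π π' : ℕ → S → A → ℝ} {h k : ℕ}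

lemma eq_zero_of_sum_eq_one {α : Type*} [Fintype α] [DecidableEq α] {f : α → ℝ}
    (hf : f ∈ stdSimplex ℝ α) {K : Finset α} (hK : ∑ a ∈ K, f a = 1) {a : α} (ha : a ∉ K) :
    f a = 0 := by
  have h1 := Finset.sum_add_sum_compl K f
  rw [hf.2, hK, add_eq_left, Finset.sum_eq_zero_iff_of_nonneg fun b _ => hf.1 b] at h1
  exact h1 a (Finset.mem_compl.2 ha)

lemma IsPolicyFrom.mono (hπ : M.IsPolicyFrom k π) (hkh : k ≤ h) : M.IsPolicyFrom h π :=
  fun j hj => hπ j (hkh.trans hj)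

lemma IsPolicy.isPolicyFrom (hπ : M.IsPolicy π) : M.IsPolicyFrom k π :=
  fun h _ => hπ h

lemma IsPolicyFrom.nonneg (hπ : M.IsPolicyFrom h π) (hh : h < M.horizon) {s : S}
    (hs : s ∈ M.states h) (a : A) : 0 ≤ π h s a :=
  (hπ h le_rfl hh s hs).1.1 a

lemma IsPolicyFrom.eq_zero (hπ : M.IsPolicyFrom h π) (hh : h < M.horizon) {s : S}
    (hs : s ∈ M.states h) {a : A} (ha : a ∉ M.actions s) : π h s a = 0 :=
  eq_zero_of_sum_eq_one (hπ h le_rfl hh s hs).1 (hπ h le_rfl hh s hs).2 ha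

lemma p_eq_zero (hh : h + 1 < M.horizon) {s : S} (hs : s ∈ M.states h) {a : A}
    (ha : a ∈ M.actions s) {s' : S} (hs' : s' ∉ M.states (h + 1)) : M.p s a s' = 0 :=
  eq_zero_of_sum_eq_one (M.p_mem s a) (M.p_states h hh s hs a ha) hs'

variable (M) in
/-- The total mass of the trajectories of length `n + 1` that start at epoch `h`. -/
def trajMass (π : ℕ → S → A → ℝ) (h : ℕ) (μ : S → ℝ) (n : ℕ) : ℝ :=
  ∑ τ : Fin (n + 1) → S × A, M.trajProb π h μ τ

variable (M) in
/-- The expected total reward of the epochs `h, …, h + n`. -/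
def trajReward (π : ℕ → S → A → ℝ) (h : ℕ) (μ : S → ℝ) (n : ℕ) : ℝ :=
  ∑ τ : Fin (n + 1) → S × A, M.trajProb π h μ τ * ∑ i, M.r (τ i).1 (τ i).2

lemma trajProb_cons (μ : S → ℝ) {n : ℕ} (x : S × A) (τ : Fin (n + 1) → S × A) :
    M.trajProb π h μ (Fin.cons x τ : Fin (n + 2) → S × A) =
      μ x.1 * π h x.1 x.2 * M.trajProb π (h + 1) (M.p x.1 x.2) τ := by
  unfold trajProb
  rw [Fin.prod_univ_succ, Fin.prod_univ_succ (n := n + 1)]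
  simp only [Fin.cons_zero, Fin.cons_succ, Fin.castSucc_zero, Fin.castSucc_succ, Fin.val_zero,
    add_zero, Fin.val_succ]
  have : ∀ i : Fin (n + 1), h + 1 + (i : ℕ) = h + (i + 1) := fun i => by ring
  simp only [this]
  ring

lemma sum_cons {n : ℕ} (f : (Fin (n + 2) → S × A) → ℝ) :
    ∑ τ, f τ = ∑ x : S × A, ∑ τ : Fin (n + 1) → S × A, f (Fin.cons x τ) := by
  rw [← (Fin.consEquiv fun _ : Fin (n + 2) => S × A).sum_comp, Fintype.sum_prod_type]
  rfl

lemma sum_fin_one (f : (Fin (0 + 1) → S × A) → ℝ) : ∑ τ, f τ = ∑ x : S × A, f fun _ => x :=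
  (Equiv.sum_comp (Equiv.funUnique (Fin 1) (S × A)).symm f).symm

lemma trajMass_zero (μ : S → ℝ) :
    M.trajMass π h μ 0 = ∑ x : S × A, μ x.1 * π h x.1 x.2 := by
  simp [trajMass, sum_fin_one, trajProb]

lemma trajMass_succ (μ : S → ℝ) (n : ℕ) :
    M.trajMass π h μ (n + 1) =
      ∑ x : S × A, μ x.1 * π h x.1 x.2 * M.trajMass π (h + 1) (M.p x.1 x.2) n := by
  simp only [trajMass, sum_cons, trajProb_cons, Finset.mul_sum]

lemma trajReward_zero (μ : S → ℝ) :
    M.trajReward π h μ 0 = ∑ x : S × A, μ x.1 * π h x.1 x.2 * M.r x.1 x.2 := by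
  simp [trajReward, sum_fin_one, trajProb]

lemma trajReward_succ (μ : S → ℝ) (n : ℕ) :
    M.trajReward π h μ (n + 1) =
      ∑ x : S × A, μ x.1 * π h x.1 x.2 * (M.r x.1 x.2 * M.trajMass π (h + 1) (M.p x.1 x.2) n +
        M.trajReward π (h + 1) (M.p x.1 x.2) n) := by
  simp only [trajReward, sum_cons, trajProb_cons, trajMass]
  refine Finset.sum_congr rfl fun x _ => ?_
  rw [Finset.mul_sum, ← Finset.sum_add_distrib, Finset.mul_sum]
  refine Finset.sum_congr rfl fun τ _ => ?_
  rw [Fin.sum_univ_succ]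
  simp only [Fin.cons_zero, Fin.cons_succ]
  ring

lemma trajReward_eq_sum (μ : S → ℝ) (n : ℕ) :
    M.trajReward π h μ n = ∑ s, μ s * M.trajReward π h (Pi.single s 1) n := by
  simp only [trajReward, Finset.mul_sum (s := (Finset.univ : Finset (Fin (n + 1) → S × A)))]
  rw [Finset.sum_comm]
  refine Finset.sum_congr rfl fun τ _ => ?_
  simp only [trajProb, Pi.single_apply, ite_mul, one_mul, zero_mul, mul_ite, mul_zero,
    Finset.sum_ite_eq, Finset.mem_univ, if_true]
  ring

lemma trajMass_eq_one (n : ℕ) : ∀ {h : ℕ} {μ : S → ℝ}, M.IsPolicyFrom h π → h + n < M.horizon →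
    (∀ s ∉ M.states h, μ s = 0) → ∑ s, μ s = 1 → M.trajMass π h μ n = 1 := by
  have hone : ∀ {h : ℕ} {μ : S → ℝ}, M.IsPolicyFrom h π → h < M.horizon →
      (∀ s ∉ M.states h, μ s = 0) → ∑ s, μ s = 1 → ∑ x : S × A, μ x.1 * π h x.1 x.2 = 1 := by
    intro h μ hπ hh hμ hμ1
    rw [Fintype.sum_prod_type, ← hμ1]
    refine Finset.sum_congr rfl fun s _ => ?_
    by_cases hs : s ∈ M.states h
    · simp only [← Finset.mul_sum, (hπ h le_rfl hh s hs).1.2, mul_one]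
    · simp [hμ s hs]
  induction n with
  | zero =>
    intro h μ hπ hh hμ hμ1
    rw [trajMass_zero, hone hπ hh hμ hμ1]
  | succ n ih =>
    intro h μ hπ hh hμ hμ1
    rw [trajMass_succ, ← hone hπ (by omega) hμ hμ1]
    refine Finset.sum_congr rfl fun x _ => ?_
    by_cases hs : x.1 ∈ M.states h
    swap
    · simp [hμ _ hs]
    by_cases ha : x.2 ∈ M.actions x.1
    swap
    · simp [hπ.eq_zero (by omega) hs ha]
    rw [ih (hπ.mono (Nat.le_succ h)) (by omega) (fun s' hs' => p_eq_zero (by omega) hs ha hs')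
      (M.p_mem _ _).2, mul_one]

/-- The Bellman equation. At epoch `h` itself, `π` need not be a policy: it is enough that it
vanishes at inadmissible actions. -/
theorem value_eq (hπ : M.IsPolicyFrom (h + 1) π) (hh : h < M.horizon) {μ : S → ℝ}
    (hμ : ∀ s ∉ M.states h, μ s = 0)
    (hπh : ∀ s ∈ M.states h, ∀ a ∉ M.actions s, π h s a = 0) :
    M.value π h μ = ∑ s, μ s * ∑ a, π h s a * M.qValue π h s a := by
  have hv : M.value π h μ = M.trajReward π h μ (M.horizon - 1 - h) := rfl
  simp only [Finset.mul_sum]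
  rw [hv, ← Fintype.sum_prod_type' (fun s a => μ s * (π h s a * M.qValue π h s a))]
  by_cases hlt : h + 1 < M.horizon
  · have hn : M.horizon - 1 - h = M.horizon - 1 - (h + 1) + 1 := by omega
    rw [hn, trajReward_succ]
    refine Finset.sum_congr rfl fun x _ => ?_
    by_cases hs : x.1 ∈ M.states h
    swap
    · simp [hμ _ hs]
    by_cases ha : x.2 ∈ M.actions x.1
    swap
    · simp [hπh _ hs _ ha]
    rw [trajMass_eq_one _ hπ (by omega) (fun s' hs' => p_eq_zero hlt hs ha hs') (M.p_mem _ _).2,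
      trajReward_eq_sum, qValue, if_pos hlt, mul_one, mul_assoc]
    congr 3
    refine (Finset.sum_subset (Finset.subset_univ _) fun s' _ hs' => ?_).symm
    rw [p_eq_zero hlt hs ha hs', zero_mul]
  · have hn : M.horizon - 1 - h = 0 := by omega
    rw [hn, trajReward_zero]
    simp only [qValue, if_neg hlt, add_zero, mul_assoc]

lemma stateValue_eq (hπ : M.IsPolicyFrom h π) (hh : h < M.horizon) {s : S}
    (hs : s ∈ M.states h) :
    M.stateValue π h s = ∑ a ∈ M.actions s, π h s a * M.qValue π h s a := by
  rw [stateValue, value_eq (hπ.mono (Nat.le_succ h)) hh (fun s' hs' => ?_)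
    (fun s hs a ha => hπ.eq_zero hh hs ha), Finset.sum_eq_single s]
  · rw [Pi.single_eq_same, one_mul]
    refine (Finset.sum_subset (Finset.subset_univ _) fun a _ ha => ?_).symm
    rw [hπ.eq_zero hh hs ha, zero_mul]
  · intro s' _ hs'
    rw [Pi.single_eq_of_ne hs', zero_mul]
  · simp
  · exact Pi.single_eq_of_ne (by rintro rfl; exact hs' hs) 1

lemma value_congr (hh : h < M.horizon) (hππ' : ∀ k, h ≤ k → k < M.horizon → π k = π' k)
    (μ : S → ℝ) : M.value π h μ = M.value π' h μ := by
  unfold value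
  refine Finset.sum_congr rfl fun τ _ => ?_
  have : M.trajProb π h μ τ = M.trajProb π' h μ τ := by
    unfold trajProb
    congr 1
    refine Finset.prod_congr rfl fun i _ => ?_
    rw [hππ' (h + i) (by omega) (by omega)]
  rw [this]

lemma qValue_congr (hππ' : ∀ k, h < k → k < M.horizon → π k = π' k) :
    M.qValue π h = M.qValue π' h := by
  ext s a
  unfold qValue
  congr 1
  split_ifs with hlt
  · refine Finset.sum_congr rfl fun s' _ => ?_
    rw [stateValue, stateValue, value_congr hlt fun k hk => hππ' k hk]
  · rfl

lemma qValue_mem {R : ℝ} (hr : ∀ s, ∀ a ∈ M.actions s, 0 ≤ M.r s a ∧ M.r s a ≤ R)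
    (hh : h < M.horizon) (hπ : M.IsPolicyFrom (h + 1) π) {s : S} (hs : s ∈ M.states h) {a : A}
    (ha : a ∈ M.actions s) :
    0 ≤ M.qValue π h s a ∧ M.qValue π h s a ≤ ((M.horizon : ℝ) - h) * R := by
  obtain ⟨n, hn⟩ : ∃ n, M.horizon = h + 1 + n := ⟨M.horizon - (h + 1), by omega⟩
  induction n generalizing h s a with
  | zero =>
    rw [qValue, if_neg (by omega), add_zero, hn]
    push_cast
    have := hr s a ha
    constructor
    · exact this.1
    · linarith [this.2]
  | succ n ih =>
    have hlt : h + 1 < M.horizon := by omega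
    have hv : ∀ s' ∈ M.states (h + 1), 0 ≤ M.stateValue π (h + 1) s' ∧
        M.stateValue π (h + 1) s' ≤ ((M.horizon : ℝ) - (h + 1)) * R := by
      intro s' hs'
      have hq := fun a ha => ih hlt (hπ.mono (Nat.le_succ _)) (s := s') hs' (a := a) ha (by omega)
      rw [stateValue_eq hπ hlt hs']
      constructor
      · exact Finset.sum_nonneg fun a ha => mul_nonneg (hπ.nonneg hlt hs' a) (hq a ha).1
      · calc _ ≤ ∑ a ∈ M.actions s', π (h + 1) s' a * (((M.horizon : ℝ) - (h + 1)) * R) := by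
              refine Finset.sum_le_sum fun a ha =>
                mul_le_mul_of_nonneg_left ?_ (hπ.nonneg hlt hs' a)
              exact_mod_cast (hq a ha).2
          _ = _ := by rw [← Finset.sum_mul, (hπ _ le_rfl hlt s' hs').2, one_mul]
    rw [qValue, if_pos hlt]
    have h1 : 0 ≤ ∑ s' ∈ M.states (h + 1), M.p s a s' * M.stateValue π (h + 1) s' :=
      Finset.sum_nonneg fun s' hs' => mul_nonneg ((M.p_mem s a).1 s') (hv s' hs').1
    have h2 : ∑ s' ∈ M.states (h + 1), M.p s a s' * M.stateValue π (h + 1) s' ≤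
        ((M.horizon : ℝ) - (h + 1)) * R := by
      calc _ ≤ ∑ s' ∈ M.states (h + 1), M.p s a s' * (((M.horizon : ℝ) - (h + 1)) * R) :=
            Finset.sum_le_sum fun s' hs' =>
              mul_le_mul_of_nonneg_left (hv s' hs').2 ((M.p_mem s a).1 s')
        _ = _ := by rw [← Finset.sum_mul, M.p_states h hlt s hs a ha, one_mul]
    have := hr s a ha
    constructor
    · linarith [this.1]
    · linarith [this.2]

/-- If at every state of every epoch the value of `π` is within `δ` of the best state-action value
of `π`, then no policy is better than `π` by more than `δ` per remaining epoch. -/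
lemma stateValue_le_add {δ : ℝ} {h : ℕ} (hπ : M.IsPolicyFrom h π)
    (hδ : ∀ k < M.horizon, ∀ s ∈ M.states k, ∀ a ∈ M.actions s,
      M.qValue π k s a ≤ M.stateValue π k s + δ)
    (hπ' : M.IsPolicyFrom h π') (hh : h < M.horizon) {s : S} (hs : s ∈ M.states h) :
    M.stateValue π' h s ≤ M.stateValue π h s + ((M.horizon : ℝ) - h) * δ := by
  have hq : ∀ a ∈ M.actions s,
      M.qValue π' h s a ≤ M.qValue π h s a + ((M.horizon : ℝ) - (h + 1)) * δ := by
    intro a ha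
    by_cases hlt : h + 1 < M.horizon
    · have hv : ∀ s' ∈ M.states (h + 1), M.stateValue π' (h + 1) s' ≤
          M.stateValue π (h + 1) s' + ((M.horizon : ℝ) - (h + 1)) * δ := fun s' hs' => by
        have := stateValue_le_add (hπ.mono (Nat.le_succ h)) hδ
          (hπ'.mono (Nat.le_succ h)) hlt hs'
        rwa [Nat.cast_succ] at this
      have : ∑ s' ∈ M.states (h + 1), M.p s a s' * M.stateValue π' (h + 1) s' ≤
          ∑ s' ∈ M.states (h + 1), M.p s a s' *
            (M.stateValue π (h + 1) s' + ((M.horizon : ℝ) - (h + 1)) * δ) :=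
        Finset.sum_le_sum fun s' hs' =>
          mul_le_mul_of_nonneg_left (hv s' hs') ((M.p_mem s a).1 s')
      simp only [mul_add, Finset.sum_add_distrib, ← Finset.sum_mul, M.p_states h hlt s hs a ha,
        one_mul] at this
      simp only [qValue, if_pos hlt]
      linarith
    · have hH : (M.horizon : ℝ) = h + 1 := by exact_mod_cast (by omega : M.horizon = h + 1)
      simp only [qValue, if_neg hlt, hH, sub_self, zero_mul, add_zero, le_refl]
  rw [stateValue_eq hπ' hh hs]
  calc _ ≤ ∑ a ∈ M.actions s, π' h s a * (M.stateValue π h s + ((M.horizon : ℝ) - h) * δ) :=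
        Finset.sum_le_sum fun a ha => mul_le_mul_of_nonneg_left
          (by linarith [hq a ha, hδ h hh s hs a ha]) (hπ'.nonneg hh hs a)
    _ = _ := by rw [← Finset.sum_mul, (hπ' h le_rfl hh s hs).2, one_mul]
termination_by M.horizon - h

end

end FiniteMDP

namespace SoftmaxBandit

/-! ### The gradient of the objective -/

lemma hasFDerivAt_mean {ι E : Type*} [NormedAddCommGroup E] [NormedSpace ℝ E] {K : Finset ι}
    (hK : K.Nonempty) (Q : ι → ℝ) (l : E → ι → ℝ) (l' : ι → E →L[ℝ] ℝ) (x : E)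
    (hl : ∀ a ∈ K, HasFDerivAt (fun y => l y a) (l' a) x) :
    HasFDerivAt (fun y => mean K Q (l y))
      (∑ a ∈ K, (weight K (l x) a * (Q a - mean K Q (l x))) • l' a) x := by
  have hZ : HasFDerivAt (fun y => ∑ a ∈ K, Real.exp (l y a))
      (∑ a ∈ K, Real.exp (l x a) • l' a) x := HasFDerivAt.fun_sum fun a ha => (hl a ha).exp
  have hN : HasFDerivAt (fun y => ∑ a ∈ K, Real.exp (l y a) * Q a)
      (∑ a ∈ K, Q a • Real.exp (l x a) • l' a) x :=
    HasFDerivAt.fun_sum fun a ha => (hl a ha).exp.mul_const (Q a)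
  have hZ0 := (sum_exp_pos hK (l x)).ne'
  have hmean : ∀ θ : ι → ℝ,
      mean K Q θ = (∑ a ∈ K, Real.exp (θ a) * Q a) * (∑ a ∈ K, Real.exp (θ a))⁻¹ := fun θ => by
    rw [mean, Finset.sum_mul]
    exact Finset.sum_congr rfl fun a _ => by unfold weight; ring
  have h := hN.mul ((hasDerivAt_inv hZ0).comp_hasFDerivAt x hZ)
  refine (h.congr_fderiv ?_).congr_of_eventuallyEq (.of_forall fun y => hmean (l y))
  ext y
  have hm := hmean (l x)
  unfold weight
  generalize mean K Q (l x) = v at *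
  simp only [add_apply, smul_apply, sum_apply, smul_eq_mul, Function.comp_apply]
  set Z := ∑ a ∈ K, Real.exp (l x a)
  have e1 : ∑ a ∈ K, Real.exp (l x a) / Z * (Q a - v) * l' a y =
      Z⁻¹ * (∑ a ∈ K, Q a * (Real.exp (l x a) * l' a y) -
        v * ∑ a ∈ K, Real.exp (l x a) * l' a y) := by
    rw [Finset.mul_sum, ← Finset.sum_sub_distrib, Finset.mul_sum]
    exact Finset.sum_congr rfl fun a _ => by ring
  rw [e1, hm]
  field_simp
  ring

end SoftmaxBandit

namespace FiniteMDP

noncomputable section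

set_option linter.unusedSectionVars false

variable {S A : Type*} [Fintype S] [Fintype A] [DecidableEq S] [DecidableEq A]
  {M : FiniteMDP S A} {π π' : ℕ → S → A → ℝ} {h k : ℕ}

open SoftmaxBandit

variable (M) in
/-- The coordinate `θ ↦ θ(s, a)` as a continuous linear form, extended by zero to pairs that are
not admissible at epoch `h`. -/
def logit (h : ℕ) (s : S) (a : A) : M.Param h →L[ℝ] ℝ :=
  if hx : s ∈ M.states h ∧ a ∈ M.actions s then EuclideanSpace.proj ⟨(s, a), hx⟩ else 0

lemma logit_apply (θ : M.Param h) (x : M.Pair h) : M.logit h x.1.1 x.1.2 θ = θ x := by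
  rw [logit, dif_pos x.2]
  rfl

lemma logit_single (x : M.Pair h) {s : S} {a : A} (hs : s ∈ M.states h) (ha : a ∈ M.actions s) :
    M.logit h s a (EuclideanSpace.single x 1) = if (s, a) = x.1 then 1 else 0 := by
  rw [logit_apply _ ⟨(s, a), hs, ha⟩]
  simp [PiLp.single_apply, Subtype.ext_iff]

lemma expParam_eq (θ : M.Param h) {s : S} (hs : s ∈ M.states h) {a : A}
    (ha : a ∈ M.actions s) : M.expParam θ s a = Real.exp (M.logit h s a θ) := by
  rw [logit_apply θ ⟨(s, a), hs, ha⟩, expParam, dif_pos ⟨hs, ha⟩]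

lemma softmax_eq_zero (θ : M.Param h) {s : S} {a : A} (ha : a ∉ M.actions s) :
    M.softmax θ s a = 0 := by
  rw [softmax, expParam, dif_neg fun hx => ha hx.2, zero_div]

lemma softmax_eq_weight (θ : M.Param h) {s : S} (hs : s ∈ M.states h) {a : A}
    (ha : a ∈ M.actions s) :
    M.softmax θ s a = weight (M.actions s) (fun b => M.logit h s b θ) a := by
  rw [softmax, weight, expParam_eq θ hs ha, ← Finset.sum_subset (Finset.subset_univ _)
    (fun b _ hb => dif_neg fun hx => hb hx.2)]
  exact congrArg _ (Finset.sum_congr rfl fun b hb => expParam_eq θ hs hb)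

lemma sum_softmax_mul (θ : M.Param h) {s : S} (hs : s ∈ M.states h) (f : A → ℝ) :
    ∑ a, M.softmax θ s a * f a = mean (M.actions s) f fun b => M.logit h s b θ := by
  rw [mean, ← Finset.sum_subset (Finset.subset_univ (M.actions s))
    (fun b _ hb => by rw [softmax_eq_zero θ hb, zero_mul])]
  exact Finset.sum_congr rfl fun a ha => by rw [softmax_eq_weight θ hs ha]

lemma softmax_mem (θ : M.Param h) {s : S} (hs : s ∈ M.states h) :
    M.softmax θ s ∈ stdSimplex ℝ A ∧ ∑ a ∈ M.actions s, M.softmax θ s a = 1 := by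
  have h1 : ∑ a ∈ M.actions s, M.softmax θ s a = 1 := by
    rw [Finset.sum_congr rfl fun a ha => softmax_eq_weight θ hs ha,
      sum_weight (M.actions_nonempty s)]
  refine ⟨⟨fun a => ?_, ?_⟩, h1⟩
  · by_cases ha : a ∈ M.actions s
    · rw [softmax_eq_weight θ hs ha]
      exact (weight_pos (M.actions_nonempty s) _ a).le
    · exact (softmax_eq_zero θ ha).ge
  · rw [← h1, Finset.sum_subset (Finset.subset_univ _) fun b _ hb => softmax_eq_zero θ hb]

lemma objective_eq (hπ : M.IsPolicyFrom (h + 1) π) (hh : h < M.horizon) {μ : S → ℝ}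
    (hμ : ∀ s ∉ M.states h, μ s = 0) (θ : M.Param h) :
    M.objective π h μ θ = ∑ s ∈ M.states h,
      μ s * mean (M.actions s) (M.qValue π h s) fun b => M.logit h s b θ := by
  have hup : ∀ k, h < k → k < M.horizon → Function.update π h (M.softmax θ) k = π k :=
    fun k hk _ => Function.update_of_ne hk.ne' _ _
  rw [objective, value_eq (fun k hk hkH s hs => ?_) hh hμ fun s _ a ha => ?_, qValue_congr hup]
  · rw [← Finset.sum_subset (Finset.subset_univ (M.states h))
      fun s _ hs => by rw [hμ s hs, zero_mul]]
    refine Finset.sum_congr rfl fun s hs => ?_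
    rw [Function.update_self, sum_softmax_mul θ hs]
  · rw [hup k hk hkH]
    exact hπ k hk hkH s hs
  · rw [Function.update_self, softmax_eq_zero θ ha]

/-- The objective of an epoch is a sum of bandit objectives, one for each state, in disjoint sets
of variables. -/
lemma gradient_objective_apply (hπ : M.IsPolicyFrom (h + 1) π) (hh : h < M.horizon) {μ : S → ℝ}
    (hμ : ∀ s ∉ M.states h, μ s = 0) (θ : M.Param h) {s : S} (hs : s ∈ M.states h) {a : A}
    (ha : a ∈ M.actions s) :
    gradient (M.objective π h μ) θ ⟨(s, a), hs, ha⟩ =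
      μ s * (weight (M.actions s) (fun b => M.logit h s b θ) a *
        (M.qValue π h s a - mean (M.actions s) (M.qValue π h s) fun b => M.logit h s b θ)) := by
  have hder : HasFDerivAt (M.objective π h μ)
      (∑ s ∈ M.states h, μ s • ∑ a ∈ M.actions s,
        (weight (M.actions s) (fun b => M.logit h s b θ) a * (M.qValue π h s a -
          mean (M.actions s) (M.qValue π h s) fun b => M.logit h s b θ)) • M.logit h s a) θ := by
    rw [funext fun θ => objective_eq hπ hh hμ θ]
    exact HasFDerivAt.fun_sum fun s _ => (hasFDerivAt_mean (M.actions_nonempty s) _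
      (fun θ b => M.logit h s b θ) (fun b => M.logit h s b) θ
      fun b _ => (M.logit h s b).hasFDerivAt).const_mul (μ s)
  set x : M.Pair h := ⟨(s, a), hs, ha⟩ with hx
  have hcoord : gradient (M.objective π h μ) θ x =
      fderiv ℝ (M.objective π h μ) θ (EuclideanSpace.single x 1) := by
    rw [← toDual_gradient, InnerProductSpace.toDual_apply_apply,
      EuclideanSpace.inner_single_right]
    simp
  rw [hcoord, hder.fderiv]
  simp only [smul_apply, sum_apply, smul_eq_mul]
  rw [Finset.sum_eq_single_of_mem s hs, Finset.sum_eq_single_of_mem a ha,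
    logit_single x hs ha, if_pos rfl, mul_one]
  · intro b hb hba
    rw [logit_single x hs hb, if_neg fun heq => hba (Prod.ext_iff.1 heq).2, mul_zero]
  · intro s' hs' hne
    rw [Finset.sum_eq_zero, mul_zero]
    intro b hb
    rw [logit_single x hs' hb, if_neg fun heq => hne (Prod.ext_iff.1 heq).1, mul_zero]

lemma gradAscent_isAscent (hπ : M.IsPolicyFrom (h + 1) π) (hh : h < M.horizon) {μ : S → ℝ}
    (hμ : ∀ s ∉ M.states h, μ s = 0) (η : ℝ) (θ₀ : M.Param h) {s : S} (hs : s ∈ M.states h) :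
    IsAscent (M.actions s) (M.qValue π h s) (η * μ s)
      (fun n a => M.logit h s a (M.gradAscent π h μ η θ₀ n)) := by
  intro n a ha
  simp only [gradAscent, map_add, map_smul, smul_eq_mul]
  rw [logit_apply (gradient _ _) ⟨(s, a), hs, ha⟩, gradient_objective_apply hπ hh hμ _ hs ha,
    mul_assoc]

/-! ### Dynamic policy gradient -/

variable {η : ℕ → ℝ} {μ : ℕ → S → ℝ} {θ₀ : (h : ℕ) → M.Param h} {N : ℕ → ℕ}

lemma trained_eq_finalPolicy (hkH : k ≤ M.horizon) (hk : M.horizon ≤ h + k) (hh : h < M.horizon) :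
    M.trained η μ θ₀ N k h = M.finalPolicy η μ θ₀ N h := by
  induction k with
  | zero => omega
  | succ k ih =>
    rw [trained]
    by_cases heq : h = M.horizon - 1 - k
    · subst heq
      have hkk : M.horizon - 1 - (M.horizon - 1 - k) = k := by omega
      simp only [Function.update_self, finalPolicy, iterate, hkk]
    · rw [Function.update_of_ne heq]
      exact ih (by omega) (by omega)

lemma finalPolicy_isPolicy : M.IsPolicy (M.finalPolicy η μ θ₀ N) :=
  fun _ _ _ hs => softmax_mem _ hs

lemma iterate_isAscent (hh : h < M.horizon) (hμ : ∀ s ∉ M.states h, μ h s = 0) {s : S}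
    (hs : s ∈ M.states h) :
    IsAscent (M.actions s) (M.qValue (M.finalPolicy η μ θ₀ N) h s) (η h * μ h s)
      (fun n a => M.logit h s a (M.iterate η μ θ₀ N h n)) := by
  have htr : ∀ k, h < k → k < M.horizon →
      M.trained η μ θ₀ N (M.horizon - 1 - h) k = M.finalPolicy η μ θ₀ N k := fun k hk hkH =>
    trained_eq_finalPolicy (by omega) (by omega) hkH
  rw [← qValue_congr htr]
  refine gradAscent_isAscent (fun k hk hkH s hs => ?_) hh hμ _ _ hs
  rw [htr k hk hkH]
  exact finalPolicy_isPolicy k hkH s hs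

lemma cConst_le (aStar : ℕ → S → A) {s : S} (hs : s ∈ M.states h) (n : ℕ) :
    M.cConst η μ θ₀ N aStar h ≤ M.softmax (M.iterate η μ θ₀ N h n) s (aStar h s) := by
  have h0 : ∀ n, 0 ≤ ⨅ s : M.states h, M.softmax (M.iterate η μ θ₀ N h n) s (aStar h s) :=
    fun n => Real.iInf_nonneg fun s => (softmax_mem _ s.2).1.1 _
  exact (ciInf_le ⟨0, by rintro _ ⟨n, rfl⟩; exact h0 n⟩ n).trans
    (ciInf_le (Set.finite_range _).bddBelow (⟨s, hs⟩ : M.states h))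

lemma le_cConst (aStar : ℕ → S → A) (hne : (M.states h).Nonempty) {c : ℝ}
    (hc : ∀ s ∈ M.states h, ∀ n, c ≤ M.softmax (M.iterate η μ θ₀ N h n) s (aStar h s)) :
    c ≤ M.cConst η μ θ₀ N aStar h := by
  have : Nonempty (M.states h) := hne.to_subtype
  exact le_ciInf fun n => le_ciInf fun s => hc s s.2 n

lemma invNorm_ge (ν : S → ℝ) {s : S} (hs : s ∈ M.states h) : 1 / ν s ≤ M.invNorm h ν :=
  le_ciSup (f := fun s : M.states h => 1 / ν s) (Set.finite_range _).bddAbove ⟨s, hs⟩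

/-- From uniform logits, a best action is never overtaken by another action. -/
lemma IsUniform.inv_card_le (hθ₀ : M.IsUniform (θ₀ h)) (hh : h < M.horizon)
    (hμ : ∀ s ∉ M.states h, μ h s = 0) {s : S} (hs : s ∈ M.states h) (ht : 0 ≤ η h * μ h s)
    {a : A} (ha : a ∈ M.actions s)
    (hmax : ∀ b ∈ M.actions s, M.qValue (M.finalPolicy η μ θ₀ N) h s b ≤
      M.qValue (M.finalPolicy η μ θ₀ N) h s a) (n : ℕ) :
    1 / (Fintype.card A : ℝ) ≤ M.softmax (M.iterate η μ θ₀ N h n) s a := by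
  have hK := M.actions_nonempty s
  rw [softmax_eq_weight _ hs ha]
  refine le_trans ?_ ((iterate_isAscent hh hμ hs).inv_card_le_weight hK ht ha hmax ?_ n)
  · exact one_div_le_one_div_of_le (by exact_mod_cast hK.card_pos)
      (by exact_mod_cast Finset.card_le_univ _)
  · intro b hb
    have h1 : M.softmax (θ₀ h) s b = M.softmax (θ₀ h) s a := by
      rw [hθ₀ s hs b hb, hθ₀ s hs a ha]
    rw [softmax_eq_weight _ hs ha, softmax_eq_weight _ hs hb, weight, weight,
      div_left_inj' (sum_exp_pos hK _).ne', Real.exp_eq_exp] at h1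
    exact h1.le

section Convergence

variable {R : ℝ} (hR : 0 < R) (hr : ∀ s, ∀ a ∈ M.actions s, 0 ≤ M.r s a ∧ M.r s a ≤ R)
  (hμ : ∀ h < M.horizon, (∀ s ∈ M.states h, 0 < μ h s) ∧ (∀ s ∉ M.states h, μ h s = 0) ∧
    ∑ s, μ h s = 1)
  (hη : ∀ h < M.horizon, η h = 1 / (2 * ((M.horizon : ℝ) - h) * R))

lemma horizon_sub_pos (hh : h < M.horizon) : 0 < (M.horizon : ℝ) - h :=
  sub_pos.2 (by exact_mod_cast hh)

include hR hμ hη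

lemma stepSize_pos (hh : h < M.horizon) {s : S} (hs : s ∈ M.states h) : 0 < η h * μ h s := by
  have := horizon_sub_pos hh
  rw [hη h hh]
  exact mul_pos (by positivity) ((hμ h hh).1 s hs)

lemma stepSize_mul_le (hh : h < M.horizon) (s : S) :
    η h * μ h s * (((M.horizon : ℝ) - h) * R) ≤ 1 / 2 := by
  have := horizon_sub_pos hh
  have hle : μ h s ≤ 1 := by
    rw [← (hμ h hh).2.2]
    refine Finset.single_le_sum (f := μ h) (fun s' _ => ?_) (Finset.mem_univ s)
    by_cases hs' : s' ∈ M.states h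
    · exact ((hμ h hh).1 s' hs').le
    · exact ((hμ h hh).2.1 s' hs').ge
  have : η h * μ h s * (((M.horizon : ℝ) - h) * R) = μ h s / 2 := by
    rw [hη h hh]
    field_simp
  linarith

include hr

lemma exists_bestAction : ∃ aStar, M.IsBestAction (M.finalPolicy η μ θ₀ N) aStar ∧
    ∀ h < M.horizon, 0 < M.cConst η μ θ₀ N aStar h := by
  have hex : ∀ h s, ∃ a, ∃ c : ℝ, h < M.horizon → s ∈ M.states h → a ∈ M.actions s ∧
      (∀ b ∈ M.actions s, M.qValue (M.finalPolicy η μ θ₀ N) h s b ≤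
        M.qValue (M.finalPolicy η μ θ₀ N) h s a) ∧
      0 < c ∧ ∀ n, c ≤ M.softmax (M.iterate η μ θ₀ N h n) s a := by
    intro h s
    by_cases hhs : h < M.horizon ∧ s ∈ M.states h
    swap
    · exact ⟨(M.actions_nonempty s).choose, 0, fun hh hs => absurd ⟨hh, hs⟩ hhs⟩
    obtain ⟨hh, hs⟩ := hhs
    obtain ⟨a, ha, hmax, c, hc, hw⟩ :=
      (iterate_isAscent (η := η) (θ₀ := θ₀) (N := N) hh (hμ h hh).2.1 hs).exists_weight_ge
        (M.actions_nonempty s) (stepSize_pos hR hμ hη hh hs)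
        (fun a ha => qValue_mem hr hh finalPolicy_isPolicy.isPolicyFrom hs ha)
        (stepSize_mul_le hR hμ hη hh s)
    refine ⟨a, c, fun _ _ => ⟨ha, hmax, hc, fun n => ?_⟩⟩
    rw [softmax_eq_weight _ hs ha]
    exact hw n
  choose aStar c hac using hex
  refine ⟨aStar, fun h hh s hs => ⟨(hac h s hh hs).1, (hac h s hh hs).2.1⟩, fun h hh => ?_⟩
  have hne : (M.states h).Nonempty := by
    by_contra hemp
    have h1 := (hμ h hh).2.2
    rw [Finset.sum_eq_zero fun s _ => (hμ h hh).2.1 s fun hs => hemp ⟨s, hs⟩] at h1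
    exact zero_ne_one h1
  obtain ⟨s₀, hs₀, hmin⟩ := (M.states h).exists_min_image (c h) hne
  exact (hac h s₀ hh hs₀).2.2.1.trans_le
    (le_cConst aStar hne fun s hs n => (hmin s hs).trans ((hac h s hh hs).2.2.2 n))

/-- After the prescribed number of steps, the error of an epoch is at most `ε / horizon`. -/
lemma qValue_le_stateValue_add {ε : ℝ} (hε : 0 < ε) (hh : h < M.horizon) {s : S}
    (hs : s ∈ M.states h) {a : A} (ha : a ∈ M.actions s)
    (hmax : ∀ b ∈ M.actions s, M.qValue (M.finalPolicy η μ θ₀ N) h s b ≤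
      M.qValue (M.finalPolicy η μ θ₀ N) h s a) {c : ℝ} (hc : 0 < c)
    (hw : ∀ n, c ≤ M.softmax (M.iterate η μ θ₀ N h n) s a)
    (hN : M.steps R ε h (μ h) c ≤ N h) :
    M.qValue (M.finalPolicy η μ θ₀ N) h s a ≤
      M.stateValue (M.finalPolicy η μ θ₀ N) h s + ε / M.horizon := by
  have hK := M.actions_nonempty s
  have hrate := (iterate_isAscent (η := η) (θ₀ := θ₀) (N := N) hh (hμ h hh).2.1 hs).rate hK
    (stepSize_pos hR hμ hη hh hs).le
    (fun a ha => qValue_mem hr hh finalPolicy_isPolicy.isPolicyFrom hs ha)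
    (stepSize_mul_le hR hμ hη hh s) ha hmax hc.le
    (fun n => (hw n).trans_eq (softmax_eq_weight _ hs ha)) (N h)
  have hval : M.stateValue (M.finalPolicy η μ θ₀ N) h s = mean (M.actions s)
      (M.qValue (M.finalPolicy η μ θ₀ N) h s)
      (fun a => M.logit h s a (M.iterate η μ θ₀ N h (N h))) := by
    rw [stateValue_eq finalPolicy_isPolicy.isPolicyFrom hh hs]
    exact Finset.sum_congr rfl fun a ha => by rw [finalPolicy, softmax_eq_weight _ hs ha]
  rw [← hval, hη h hh] at hrate
  have hμs := (hμ h hh).1 s hs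
  have hD := horizon_sub_pos hh
  have hH : (0 : ℝ) < M.horizon := by exact_mod_cast M.horizon_pos
  have hNge : 4 * ((M.horizon : ℝ) - h) * M.horizon * R / (c ^ 2 * ε) * (1 / μ h s) ≤ N h :=
    (mul_le_mul_of_nonneg_left (invNorm_ge (μ h) hs) (by positivity)).trans hN
  by_contra! hlt
  set D := (M.horizon : ℝ) - h
  set κ := 1 / (2 * D * R) * μ h s * c ^ 2 / 2 with hκ
  have hκ0 : 0 < κ := by positivity
  have hN0 : (0 : ℝ) < N h := lt_of_lt_of_le (by positivity) hNge
  -- the number of steps is calibrated such that `N h * κ * (ε / horizon) ≥ 1`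
  have hone : 4 * D * M.horizon * R / (c ^ 2 * ε) * (1 / μ h s) * (κ * (ε / M.horizon)) = 1 := by
    rw [hκ]
    field_simp
    norm_num
  have h1 : (1 : ℝ) ≤ N h * (κ * (ε / M.horizon)) :=
    hone.symm.le.trans (mul_le_mul_of_nonneg_right hNge (by positivity))
  have h2 := mul_lt_mul_of_pos_left (mul_lt_mul_of_pos_left (lt_sub_iff_add_lt'.2 hlt) hκ0) hN0
  linarith

lemma optValue_sub_le {ε : ℝ} (hε : 0 < ε) {aStar : ℕ → S → A}
    (hbest : M.IsBestAction (M.finalPolicy η μ θ₀ N) aStar)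
    (hN : ∀ h < M.horizon,
      (0 < M.cConst η μ θ₀ N aStar h ∧
        M.steps R ε h (μ h) (M.cConst η μ θ₀ N aStar h) ≤ N h) ∨
      (M.IsUniform (θ₀ h) ∧ M.steps R ε h (μ h) (1 / (Fintype.card A : ℝ)) ≤ N h))
    {s : S} (hs : s ∈ M.states 0) :
    M.optValue s - M.stateValue (M.finalPolicy η μ θ₀ N) 0 s ≤ ε := by
  have hgap : ∀ h < M.horizon, ∀ s ∈ M.states h, ∀ a ∈ M.actions s,
      M.qValue (M.finalPolicy η μ θ₀ N) h s a ≤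
        M.stateValue (M.finalPolicy η μ θ₀ N) h s + ε / M.horizon := by
    intro h hh s hs a ha
    obtain ⟨hmem, hmax⟩ := hbest h hh s hs
    refine (hmax a ha).trans ?_
    rcases hN h hh with ⟨hc, hsteps⟩ | ⟨hunif, hsteps⟩
    · exact qValue_le_stateValue_add hR hr hμ hη hε hh hs hmem hmax hc (cConst_le aStar hs) hsteps
    · have : Nonempty A := ⟨a⟩
      exact qValue_le_stateValue_add hR hr hμ hη hε hh hs hmem hmax
        (one_div_pos.2 (by exact_mod_cast Fintype.card_pos))
        (hunif.inv_card_le hh (hμ h hh).2.1 hs (stepSize_pos hR hμ hη hh hs).le hmem hmax) hsteps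
  have : Nonempty {π : ℕ → S → A → ℝ // M.IsPolicy π} :=
    ⟨⟨M.finalPolicy η μ θ₀ N, finalPolicy_isPolicy⟩⟩
  rw [sub_le_iff_le_add']
  refine ciSup_le fun π => (stateValue_le_add finalPolicy_isPolicy.isPolicyFrom hgap
    π.2.isPolicyFrom M.horizon_pos hs).trans_eq ?_
  have hH : (M.horizon : ℝ) ≠ 0 := by exact_mod_cast M.horizon_pos.ne'
  rw [Nat.cast_zero, sub_zero, mul_div_cancel₀ _ hH]

end Convergence

end

end FiniteMDP

theorem mainTheorem1 {S A : Type*} [Fintype S] [Fintype A] [DecidableEq S] [DecidableEq A]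
    (M : FiniteMDP S A)
    (R : ℝ) (hR : 0 < R)
    (hr : ∀ s, ∀ a ∈ M.actions s, 0 ≤ M.r s a ∧ M.r s a ≤ R)
    (μ : ℕ → S → ℝ)
    (hμ : ∀ h < M.horizon, (∀ s ∈ M.states h, 0 < μ h s) ∧ (∀ s ∉ M.states h, μ h s = 0) ∧
      ∑ s, μ h s = 1)
    (η : ℕ → ℝ)
    (hη : ∀ h < M.horizon, η h = 1 / (2 * ((M.horizon : ℝ) - h) * R))
    (θ₀ : (h : ℕ) → M.Param h)
    (ε : ℝ) (hε : 0 < ε)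
    (N : ℕ → ℕ) :
    -- best actions with positive constants always exist
    (∃ aStar, M.IsBestAction (M.finalPolicy η μ θ₀ N) aStar ∧
      ∀ h < M.horizon, 0 < M.cConst η μ θ₀ N aStar h) ∧
    -- arbitrary initialisation
    (∀ aStar, M.IsBestAction (M.finalPolicy η μ θ₀ N) aStar →
      (∀ h < M.horizon, 0 < M.cConst η μ θ₀ N aStar h ∧
        M.steps R ε h (μ h) (M.cConst η μ θ₀ N aStar h) ≤ N h) →
      ∀ s ∈ M.states 0,
        M.optValue s - M.stateValue (M.finalPolicy η μ θ₀ N) 0 s ≤ ε) ∧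
    -- at every epoch with uniform initialisation, `c_h` may be replaced by `1 / |A|`
    (∀ aStar, M.IsBestAction (M.finalPolicy η μ θ₀ N) aStar →
      (∀ h < M.horizon,
        (0 < M.cConst η μ θ₀ N aStar h ∧
          M.steps R ε h (μ h) (M.cConst η μ θ₀ N aStar h) ≤ N h) ∨
        (M.IsUniform (θ₀ h) ∧ M.steps R ε h (μ h) (1 / (Fintype.card A : ℝ)) ≤ N h)) →
      ∀ s ∈ M.states 0,
        M.optValue s - M.stateValue (M.finalPolicy η μ θ₀ N) 0 s ≤ ε) := by
  refine ⟨FiniteMDP.exists_bestAction hR hr hμ hη, fun aStar hbest hN s hs => ?_,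
    fun aStar hbest hN s hs => FiniteMDP.optValue_sub_le hR hr hμ hη hε hbest hN hs⟩
  exact FiniteMDP.optValue_sub_le hR hr hμ hη hε hbest (fun h hh => Or.inl (hN h hh)) hs
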